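/- A Young diagram is a finite (possibly empty) sequence $J=(j_1,\dots,j_m)$ of integers with $j_1\ge j_2\ge\dots\ge j_m>0$. Put $N(J)=j_1+\dots+j_m$ and $n_k(J)=\#\{s\mid j_s=k\}$. Define an integer-valued function $d$ on Young diagrams recursively by $d(\emptyset)=1$ and, for nonempty $J=(j_1,\dots,j_m)$ with $N=N(J)$, $$d(J)=\sum_{1\le s\le m,\ j_s>j_{s+1}}(N-j_s+1)\,n_{j_s}(J)\,d(j_1,\dots,j_{s-1},j_s-1,j_{s+1},\dots,j_m),$$ where $j_{m+1}=0$, and where, if $s=m$ and $j_m=1$, the resulting last entry $0$ is deleted. Theorem. Let $p$ be a prime and let $J$ be a Young diagram with $N(J)=p-1$. Then $d(J)\equiv 1 \pmod p$. -/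

import Mathlib

/-- A Young diagram, given as its sequence of row lengths `j₁ ≥ j₂ ≥ ⋯ ≥ jₘ > 0`
(possibly empty). -/
def IsYoungDiagram (J : List ℕ) : Prop :=
  J.SortedGE ∧ ∀ j ∈ J, 0 < j

/-- The sequence `J` with its entry at position `s` (counted from `0`) decreased by `1`, where an
entry that becomes zero is deleted. -/
def decreaseAt (J : List ℕ) (s : Fin J.length) : List ℕ :=
  (J.set s (J[s] - 1)).filter (fun j => 0 < j)

theorem sum_decreaseAt_lt (J : List ℕ) (s : Fin J.length) (h : 0 < J[s]) :
    (decreaseAt J s).sum < J.sum := by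
  have hf : ∀ L : List ℕ, (L.filter (fun j => 0 < j)).sum = L.sum := by
    intro L
    induction L with
    | nil => rfl
    | cons a L ih =>
      rcases Nat.eq_zero_or_pos a with ha | ha
      · simp [ha, ih]
      · simp [ha, ih]
  have hs : ∀ (L : List ℕ) (i : ℕ) (hi : i < L.length), 0 < L[i] →
      (L.set i (L[i] - 1)).sum < L.sum := by
    intro L
    induction L with
    | nil => intro i hi; simp at hi
    | cons a L ih =>
      intro i hi hpos
      cases i with
      | zero => simp at hpos ⊢; omega
      | succ i =>
        simp at hi hpos ⊢
        exact ih i hi hpos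
  rw [decreaseAt, hf]
  exact hs J s s.isLt h

/-- The function `d`: `d(∅) = 1`, and for nonempty `J` with `N = j₁ + ⋯ + jₘ`,
`d(J) = ∑ (N - jₛ + 1) * n_{jₛ}(J) * d(J with jₛ decreased by 1)`, summed over the `s` with
`jₛ > jₛ₊₁`, where `jₘ₊₁ = 0` and `n_k(J)` is the number of entries of `J` equal to `k`. -/
def youngD (J : List ℕ) : ℕ :=
  if J = [] then 1
  else ∑ s : Fin J.length,
    if _h : J.getD (s + 1) 0 < J[s] then
      (J.sum - J[s] + 1) * J.count J[s] * youngD (decreaseAt J s)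
    else 0
termination_by J.sum
decreasing_by exact sum_decreaseAt_lt J s (by omega)

/-! Let `q = ∏ (1 + xᵣ t)` and `D = q d/dt`. The value `Pₙ` of `Dⁿ q` at `t = 0` is a polynomial in
the `xᵣ`, and `d(J)` is its coefficient at any monomial whose nonzero exponents are the rows of `J`,
where `n = N(J)` (`coeff_youngPolynomial`). Indeed `E = ∑ xᵣ² ∂/∂xᵣ + d/dt` commutes with `d/dt` and
multiplies `q` by `∑ xᵣ`, which yields a recursion for `Pₙ` matching that of `d`. In characteristic
`p`, `Dᵖ` is again a derivation, so `(Dᵖ f)(0) = f'(0) (Dᵖ t)(0)`, while `D t = q`. Taking for `f` a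
truncated antiderivative of `1/q` and using Wilson's theorem identifies `P_{p-1}` with the
coefficient of `t^(p-1)` in `1/q` (`vectorField_iterate_pred_eval`). Up to the sign `(-1)^(p-1) = 1`
this is the complete homogeneous polynomial, all of whose coefficients are 1. -/

/-! ### Iterates of `q d/dt` in characteristic `p` -/

section Derivations

open Polynomial Finset

theorem Derivation.iterate_leibniz {R A : Type*} [CommRing R] [CommRing A] [Algebra R A]
    (D : Derivation R A A) (n : ℕ) (a b : A) :
    D^[n] (a * b) = ∑ ij ∈ antidiagonal n, n.choose ij.1 • (D^[ij.1] a * D^[ij.2] b) := by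
  induction n with
  | zero => simp
  | succ n ih =>
    rw [sum_antidiagonal_choose_succ_nsmul (fun i j => D^[i] a * D^[j] b) n]
    simp only [Function.iterate_succ_apply', ih, map_sum, map_nsmul, Derivation.leibniz,
      smul_eq_mul, smul_add, sum_add_distrib, add_right_inj]
    refine sum_congr rfl fun ⟨i, j⟩ hij ↦ ?_
    rw [n.choose_symm_of_eq_add (mem_antidiagonal.1 hij).symm, mul_comm]

/-- In characteristic `p`, the `p`-th iterate of a derivation obeys the Leibniz rule. -/
theorem Derivation.iterate_char_leibniz {R A : Type*} [CommRing R] [CommRing A] [Algebra R A]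
    (p : ℕ) [hp : Fact p.Prime] [CharP A p] (D : Derivation R A A) (a b : A) :
    D^[p] (a * b) = a * D^[p] b + D^[p] a * b := by
  obtain ⟨m, rfl⟩ : ∃ m, p = m + 1 := ⟨p - 1, (Nat.sub_add_cancel hp.out.one_le).symm⟩
  rw [D.iterate_leibniz, Nat.sum_antidiagonal_succ, Nat.sum_antidiagonal_eq_sum_range_succ_mk,
    sum_range_succ, sum_eq_zero]
  · simp
  · intro i hi
    rw [nsmul_eq_mul, (CharP.cast_eq_zero_iff A (m + 1) _).2, zero_mul]
    exact hp.out.dvd_choose_self (Nat.succ_ne_zero i) (by simpa using hi)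

variable {S : Type*} [CommRing S]

/-- The derivation `q • d/dt` of a polynomial ring. -/
noncomputable def vectorField (q : S[X]) : Derivation S S[X] S[X] :=
  q • derivative'

theorem vectorField_apply (q f : S[X]) : vectorField q f = q * derivative f := rfl

/-- Each application lowers the order of vanishing at 0 by one, contributing the current exponent
times `q`. -/
theorem vectorField_iterate_X_pow_eval (q : S[X]) (n : ℕ) (w : S[X]) :
    ((vectorField q)^[n] (X ^ n * w)).eval 0 = n.factorial * q.eval 0 ^ n * w.eval 0 := by
  induction n generalizing w with
  | zero => simp
  | succ n ih =>
    have : vectorField q (X ^ (n + 1) * w) =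
        X ^ n * (((n + 1 : ℕ) : S[X]) * q * w + X * (q * derivative w)) := by
      rw [vectorField_apply, derivative_mul, derivative_X_pow]
      simp
      ring
    rw [Function.iterate_succ_apply, this, ih, Nat.factorial_succ]
    simp
    ring

/-- The `p`-th iterate is a linear derivation, so it kills constants and sees only the linear term
of `f` at 0. -/
theorem vectorField_iterate_char_eval {p : ℕ} [Fact p.Prime] [CharP S p] (q f : S[X]) :
    ((vectorField q)^[p] f).eval 0 = f.coeff 1 * ((vectorField q)^[p] X).eval 0 := by
  have h1 : (vectorField q)^[p] (1 : S[X]) = 0 := by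
    have := (vectorField q).iterate_char_leibniz p 1 1
    simpa using this
  have hC : ∀ c : S, (vectorField q)^[p] (C c) = 0 := by
    intro c
    have h := ((vectorField q : S[X] →ₗ[S] S[X]) ^ p).map_smul c 1
    simp only [Module.End.pow_apply, Derivation.coeFn_coe] at h
    rw [h1, smul_zero, smul_eq_C_mul, mul_one] at h
    exact h
  obtain ⟨g, hg⟩ : ∃ g, f = C (f.coeff 0) + X * (C (f.coeff 1) + X * g) := by
    refine ⟨f.divX.divX, ?_⟩
    have h2 := f.divX_mul_X_add
    have h3 := f.divX.divX_mul_X_add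
    rw [coeff_divX] at h3
    linear_combination -h2 - X * h3
  have hadd := ((vectorField q : S[X] →ₗ[S] S[X]) ^ p).map_add (C (f.coeff 0))
    (X * (C (f.coeff 1) + X * g))
  simp only [Module.End.pow_apply, Derivation.coeFn_coe] at hadd
  conv_lhs => rw [hg]
  rw [hadd, hC, (vectorField q).iterate_char_leibniz p]
  simp
  ring

/-- In characteristic `p`, the value at `0` of `(q d/dt)^(p-1) q` is the coefficient of `t^(p-1)`
in `1 / q`, for `q` with constant term `1`. -/
theorem vectorField_iterate_pred_eval {p : ℕ} [hp : Fact p.Prime] [Algebra (ZMod p) S] [CharP S p]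
    {q u w : S[X]} (hq : q.eval 0 = 1) (hu : q * u = 1 + X ^ p * w) :
    ((vectorField q)^[p - 1] q).eval 0 = u.coeff (p - 1) := by
  obtain ⟨m, rfl⟩ : ∃ m, p = m + 1 := ⟨p - 1, (Nat.sub_add_cancel hp.out.one_le).symm⟩
  simp only [Nat.add_sub_cancel]
  -- Antiderivative of `u` without its `t^(p-1)` term, whose integration would require dividing by
  -- `p`.
  set f : S[X] := ∑ k ∈ range m, monomial (k + 1)
    (algebraMap (ZMod (m + 1)) S (((k + 1 : ℕ) : ZMod (m + 1))⁻¹) * u.coeff k) with hf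
  have hfc : ∀ d, f.coeff (d + 1) = if d < m then
      algebraMap (ZMod (m + 1)) S (((d + 1 : ℕ) : ZMod (m + 1))⁻¹) * u.coeff d else 0 := by
    intro d
    simp [hf, coeff_monomial]
  obtain ⟨v, hv⟩ : ∃ v, u = derivative f + X ^ m * (C (u.coeff m) + X * v) := by
    have hdvd : X ^ (m + 1) ∣ u - derivative f - X ^ m * C (u.coeff m) := by
      refine X_pow_dvd_iff.2 fun d hd => ?_
      rw [coeff_sub, coeff_sub, coeff_derivative, hfc, coeff_X_pow_mul', coeff_C]
      rcases (Nat.lt_succ_iff.1 hd).lt_or_eq with h | rfl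
      · have hinv : algebraMap (ZMod (m + 1)) S (((d + 1 : ℕ) : ZMod (m + 1))⁻¹) *
            ((d + 1 : ℕ) : S) = 1 := by
          rw [← map_natCast (algebraMap (ZMod (m + 1)) S), ← map_mul, inv_mul_cancel₀, map_one]
          rw [Ne, ZMod.natCast_eq_zero_iff]
          exact Nat.not_dvd_of_pos_of_lt d.succ_pos (Nat.succ_lt_succ h)
        rw [if_pos h, if_neg (by omega)]
        push_cast at hinv ⊢
        linear_combination -u.coeff d * hinv
      · simp
    obtain ⟨v, hv⟩ := hdvd
    exact ⟨v, by linear_combination hv⟩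
  have hm0 : 0 < m := Nat.lt_of_succ_lt_succ hp.out.one_lt
  have hf1 : f.coeff 1 = 1 := by
    have hu0 := congrArg (eval 0) hu
    simp only [eval_mul, hq, one_mul, eval_add, eval_one, eval_pow, eval_X, ne_eq,
      Nat.succ_ne_zero, not_false_eq_true, zero_pow, zero_mul, add_zero] at hu0
    rw [hfc 0, if_pos hm0, coeff_zero_eq_eval_zero, hu0]
    simp
  have key := vectorField_iterate_char_eval (p := m + 1) q f
  rw [hf1, one_mul, Function.iterate_succ_apply, Function.iterate_succ_apply] at key
  have hX : vectorField q X = q := by simp [vectorField_apply]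
  rw [hX] at key
  rw [← key]
  -- The missing term leaves `-u_m t^m` to lowest order; its sign cancels against `m! = -1`.
  have hqf : vectorField q f = 1 + X ^ m * (X * w - q * (C (u.coeff m) + X * v)) := by
    rw [vectorField_apply]
    linear_combination hu - q * hv
  have hadd := ((vectorField q : S[X] →ₗ[S] S[X]) ^ m).map_add 1
    (X ^ m * (X * w - q * (C (u.coeff m) + X * v)))
  simp only [Module.End.pow_apply, Derivation.coeFn_coe] at hadd
  have hm : (vectorField q)^[m] (1 : S[X]) = 0 := by
    obtain ⟨l, rfl⟩ : ∃ l, m = l + 1 := ⟨m - 1, (Nat.sub_add_cancel hm0).symm⟩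
    rw [Function.iterate_succ_apply, Derivation.map_one_eq_zero]
    exact iterate_map_zero _ _
  have hw : (m.factorial : S) = -1 := by
    have := congrArg (algebraMap (ZMod (m + 1)) S) (ZMod.wilsons_lemma (m + 1))
    simpa using this
  rw [hqf, hadd, hm, zero_add, vectorField_iterate_X_pow_eval, hw, hq]
  simp [hq]

end Derivations

/-! ### Recursion for the generating polynomials, and their value at `p - 1` -/

section GeneratingPolynomials

open Finset

variable {ι : Type*} {K : Type*} [CommRing K]

theorem coeff_X_mul_pderiv (r : ι) (f : MvPolynomial ι K) (a : ι →₀ ℕ) :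
    (MvPolynomial.X r * MvPolynomial.pderiv r f).coeff a = a r * f.coeff a := by
  classical
  rw [MvPolynomial.coeff_X_mul']
  split_ifs with h
  · have h1 : 1 ≤ a r := Nat.one_le_iff_ne_zero.2 (Finsupp.mem_support_iff.1 h)
    rw [MvPolynomial.coeff_pderiv, tsub_add_cancel_of_le (Finsupp.single_le_iff.2 h1)]
    simp [Nat.cast_sub h1, mul_comm]
  · simp [Finsupp.notMem_support_iff.1 h]

variable [Fintype ι]

/-- The derivation `∑ xᵣ² ∂/∂xᵣ`. -/
noncomputable def sqDerivation (ι K : Type*) [Fintype ι] [CommRing K] :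
    Derivation K (MvPolynomial ι K) (MvPolynomial ι K) :=
  ∑ r, (MvPolynomial.X r ^ 2 : MvPolynomial ι K) • MvPolynomial.pderiv r

theorem sqDerivation_apply (f : MvPolynomial ι K) :
    sqDerivation ι K f = ∑ r, MvPolynomial.X r ^ 2 * MvPolynomial.pderiv r f := by
  rw [sqDerivation, ← Derivation.coeFnAddMonoidHom_apply, map_sum, Finset.sum_apply]
  rfl

theorem sqDerivation_X (r : ι) :
    sqDerivation ι K (MvPolynomial.X r) = MvPolynomial.X r ^ 2 := by
  classical
  simp [sqDerivation_apply, MvPolynomial.pderiv_X, Pi.single_apply]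

/-- The operator is `∑ xᵣ (n - xᵣ ∂ᵣ)`, and `xᵣ ∂ᵣ` has eigenvalue `a r - 1` on the monomial of
exponent `a - single r 1`. -/
theorem coeff_mul_sum_X_sub_sqDerivation (n : ℕ) (f : MvPolynomial ι K) (a : ι →₀ ℕ) :
    ((n : MvPolynomial ι K) * (∑ r, MvPolynomial.X r) * f - sqDerivation ι K f).coeff a =
      ∑ r, if 0 < a r then (n - a r + 1 : K) * f.coeff (a - Finsupp.single r 1) else 0 := by
  classical
  have h : ((n : MvPolynomial ι K) * (∑ r, MvPolynomial.X r) * f - sqDerivation ι K f) =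
      ∑ r, MvPolynomial.X r * (MvPolynomial.C (n : K) * f -
        MvPolynomial.X r * MvPolynomial.pderiv r f) := by
    rw [sqDerivation_apply, mul_sum, sum_mul, ← sum_sub_distrib]
    refine sum_congr rfl fun r _ => ?_
    rw [map_natCast]
    ring
  rw [h, MvPolynomial.coeff_sum]
  refine sum_congr rfl fun r _ => ?_
  rw [MvPolynomial.coeff_X_mul']
  by_cases hr : a r = 0
  · simp [hr]
  · rw [if_pos (Finsupp.mem_support_iff.2 hr), if_pos (Nat.pos_of_ne_zero hr),
      MvPolynomial.coeff_sub, MvPolynomial.coeff_C_mul, coeff_X_mul_pderiv]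
    simp [Nat.cast_sub (Nat.one_le_iff_ne_zero.2 hr)]
    ring

open Polynomial

/-- A derivation of the coefficient ring acting on the coefficients, plus `d/dt`. -/
noncomputable def totalDerivation {S : Type*} [CommRing S] [Algebra K S] (d : Derivation K S S) :
    Derivation K S[X] S[X] :=
  PolynomialModule.equivPolynomialSelf.compDer d.mapCoeffs + derivative'.restrictScalars K

theorem coeff_totalDerivation {S : Type*} [CommRing S] [Algebra K S] (d : Derivation K S S)
    (f : S[X]) (n : ℕ) :
    (totalDerivation d f).coeff n = d (f.coeff n) + f.coeff (n + 1) * (n + 1) := by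
  rw [← coeff_derivative]
  exact coeff_add _ _ n

/-- `d/dt` scales coefficients by integers, which `d` annihilates. -/
theorem totalDerivation_derivative {S : Type*} [CommRing S] [Algebra K S] (d : Derivation K S S)
    (f : S[X]) : totalDerivation d (derivative f) = derivative (totalDerivation d f) := by
  ext n
  simp only [coeff_totalDerivation, coeff_derivative, Derivation.leibniz, map_add,
    Derivation.map_natCast, Derivation.map_one_eq_zero, smul_eq_mul]
  push_cast
  ring

/-- The polynomial `∏ (1 + xᵣ t)`. -/
noncomputable def esymmPolynomial (ι K : Type*) [Fintype ι] [CommRing K] :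
    (MvPolynomial ι K)[X] :=
  ∏ r, (1 + C (MvPolynomial.X r) * X)

theorem esymmPolynomial_eval_zero : (esymmPolynomial ι K).eval 0 = 1 := by
  simp [esymmPolynomial, eval_prod]

theorem totalDerivation_esymmPolynomial :
    totalDerivation (sqDerivation ι K) (esymmPolynomial ι K) =
      C (∑ r, MvPolynomial.X r) * esymmPolynomial ι K := by
  classical
  have h : ∀ r : ι, totalDerivation (sqDerivation ι K) (1 + C (MvPolynomial.X r) * X) =
      C (MvPolynomial.X r) * (1 + C (MvPolynomial.X r) * X) := by
    intro r
    ext1 n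
    rw [coeff_totalDerivation]
    rcases n with _ | _ | n <;>
      simp [coeff_one, coeff_X, sqDerivation_X, pow_two]
  unfold esymmPolynomial
  generalize (univ : Finset ι) = s
  induction s using Finset.induction_on with
  | empty => simp
  | insert r s hr ih =>
    rw [prod_insert hr, sum_insert hr, Derivation.leibniz, ih, h, C_add]
    simp only [smul_eq_mul]
    ring

/-- The polynomials generating the function `d`. -/
noncomputable def youngPolynomial (ι K : Type*) [Fintype ι] [CommRing K] (n : ℕ) :
    MvPolynomial ι K :=
  ((vectorField (esymmPolynomial ι K))^[n] (esymmPolynomial ι K)).eval 0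

/-- Each new factor `q` contributes one more `∑ xᵣ`, which is constant in `t`. -/
theorem totalDerivation_vectorField_iterate (n : ℕ) :
    totalDerivation (sqDerivation ι K)
        ((vectorField (esymmPolynomial ι K))^[n] (esymmPolynomial ι K)) =
      ((n + 1 : ℕ) : (MvPolynomial ι K)[X]) * C (∑ r, MvPolynomial.X r) *
        (vectorField (esymmPolynomial ι K))^[n] (esymmPolynomial ι K) := by
  induction n with
  | zero => simp [totalDerivation_esymmPolynomial]
  | succ n ih =>
    rw [Function.iterate_succ_apply', vectorField_apply, Derivation.leibniz,
      totalDerivation_derivative, ih, totalDerivation_esymmPolynomial, ← C_eq_natCast, ← C_mul,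
      derivative_C_mul, C_mul]
    simp only [smul_eq_mul, C_eq_natCast]
    push_cast
    ring

theorem youngPolynomial_zero : youngPolynomial ι K 0 = 1 :=
  esymmPolynomial_eval_zero

/-- This is the constant term in `t` of the preceding identity, since `q(0) = 1`. -/
theorem youngPolynomial_succ (n : ℕ) :
    youngPolynomial ι K (n + 1) =
      ((n + 1 : ℕ) : MvPolynomial ι K) * (∑ r, MvPolynomial.X r) * youngPolynomial ι K n -
        sqDerivation ι K (youngPolynomial ι K n) := by
  have h := congrArg (fun f : (MvPolynomial ι K)[X] => f.coeff 0)
     (totalDerivation_vectorField_iterate (ι := ι) (K := K) n)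
  simp only [coeff_totalDerivation] at h
  unfold youngPolynomial
  rw [Function.iterate_succ_apply', vectorField_apply, eval_mul, esymmPolynomial_eval_zero,
    one_mul, ← coeff_zero_eq_eval_zero, ← coeff_zero_eq_eval_zero, coeff_derivative]
  rw [← C_eq_natCast, ← C_mul, coeff_C_mul] at h
  linear_combination h

theorem coeff_youngPolynomial_succ (n : ℕ) (a : ι →₀ ℕ) :
    (youngPolynomial ι K (n + 1)).coeff a = ∑ r, if 0 < a r then
      ((n + 1 : ℕ) - a r + 1 : K) * (youngPolynomial ι K n).coeff (a - Finsupp.single r 1)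
        else 0 := by
  rw [youngPolynomial_succ, coeff_mul_sum_X_sub_sqDerivation]

theorem coeff_youngPolynomial_pred {p : ℕ} [hp : Fact p.Prime] (a : ι →₀ ℕ)
    (ha : ∑ r, a r = p - 1) : (youngPolynomial ι (ZMod p) (p - 1)).coeff a = 1 := by
  classical
  -- Product of truncated geometric series: the inverse of `q` modulo `t^p`.
  set u : (MvPolynomial ι (ZMod p))[X] :=
    ∏ r, ∑ k ∈ range p, (C (-MvPolynomial.X r : MvPolynomial ι (ZMod p)) * X) ^ k with hu
  have hdvd : ∀ s : Finset ι, (X : (MvPolynomial ι (ZMod p))[X]) ^ p ∣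
      ∏ r ∈ s, (1 - (C (-MvPolynomial.X r : MvPolynomial ι (ZMod p)) * X) ^ p) - 1 := by
    intro s
    induction s using Finset.induction_on with
    | empty => simp
    | insert r s hr ih =>
      obtain ⟨w, hw⟩ := ih
      rw [prod_insert hr, eq_add_of_sub_eq hw, mul_pow]
      exact ⟨w - C (-MvPolynomial.X r) ^ p * (X ^ p * w + 1), by ring⟩
  obtain ⟨w, hw⟩ := hdvd univ
  have hqu : esymmPolynomial ι (ZMod p) * u = 1 + X ^ p * w := by
    rw [← hw, esymmPolynomial, hu, ← prod_mul_distrib, add_sub_cancel]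
    refine prod_congr rfl fun r _ => ?_
    rw [← mul_neg_geom_sum, C_neg]
    congr 1
    ring
  rw [youngPolynomial, vectorField_iterate_pred_eval esymmPolynomial_eval_zero hqu,
    ← Polynomial.coeff_coe, hu]
  rw [← coeToPowerSeries.ringHom_apply, map_prod, PowerSeries.coeff_prod]
  have hc : ∀ (r : ι) (k : ℕ), k < p → PowerSeries.coeff k (coeToPowerSeries.ringHom
      (∑ k ∈ range p, (C (-MvPolynomial.X r : MvPolynomial ι (ZMod p)) * X) ^ k)) =
      (-1) ^ k * MvPolynomial.X r ^ k := by
    intro r k hk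
    rw [coeToPowerSeries.ringHom_apply, Polynomial.coeff_coe, finsetSum_coeff,
      sum_eq_single_of_mem k (mem_range.2 hk)]
    · rw [mul_pow, ← C_pow, coeff_C_mul_X_pow, if_pos rfl, neg_pow]
    · intro j _ hj
      rw [mul_pow, ← C_pow, coeff_C_mul_X_pow, if_neg hj.symm]
  have hsign : (-1 : MvPolynomial ι (ZMod p)) ^ (p - 1) = 1 := by
    have := congrArg (MvPolynomial.C (σ := ι))
      (ZMod.pow_card_sub_one_eq_one (p := p) (a := -1) (by simp))
    simpa using this
  have hterm : ∀ l ∈ finsuppAntidiag univ (p - 1), ∏ r, PowerSeries.coeff (l r)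
      (coeToPowerSeries.ringHom (∑ k ∈ range p,
        (C (-MvPolynomial.X r : MvPolynomial ι (ZMod p)) * X) ^ k)) =
      MvPolynomial.monomial l 1 := by
    intro l hl
    have hl' := (mem_finsuppAntidiag.1 hl).1
    rw [prod_congr rfl fun r _ => hc r (l r) ?_, prod_mul_distrib, prod_pow_eq_pow_sum, hl',
      hsign, one_mul, MvPolynomial.monomial_eq, Finsupp.prod_fintype]
    · simp
    · simp
    · exact ((single_le_sum (fun i _ => Nat.zero_le (l i)) (mem_univ r)).trans_eq hl').trans_lt
        (Nat.sub_lt hp.out.pos one_pos)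
  rw [sum_congr rfl hterm, MvPolynomial.coeff_sum]
  simp only [MvPolynomial.coeff_monomial, sum_ite_eq']
  rw [if_pos]
  simpa [mem_finsuppAntidiag] using ha

end GeneratingPolynomials

/-! ### Corners of a diagram and comparison with the recursion for `d` -/

section Corners

open Finset

theorem IsYoungDiagram.getElem_le {J : List ℕ} (hJ : IsYoungDiagram J) {i j : ℕ} (hij : i ≤ j)
    (hj : j < J.length) : J[j] ≤ J[i]'(hij.trans_lt hj) :=
  hJ.1.antitone_get (a := ⟨i, hij.trans_lt hj⟩) (b := ⟨j, hj⟩) hij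

theorem IsYoungDiagram.getElem_lt_of_corner {J : List ℕ} (hJ : IsYoungDiagram J) {i j : ℕ}
    (hij : i < j) (hj : j < J.length) (hi : J.getD (i + 1) 0 < J[i]) : J[j] < J[i] := by
  rw [List.getD_eq_getElem _ _ (Nat.lt_of_le_of_lt hij hj)] at hi
  exact (hJ.getElem_le hij hj).trans_lt hi

theorem IsYoungDiagram.corner_unique {J : List ℕ} (hJ : IsYoungDiagram J) {s t : Fin J.length}
    (hs : J.getD (s + 1) 0 < J[s]) (ht : J.getD (t + 1) 0 < J[t]) (h : J[s] = J[t]) : s = t := by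
  rcases lt_trichotomy s t with hst | hst | hst
  · exact absurd h (hJ.getElem_lt_of_corner hst t.isLt hs).ne'
  · exact hst
  · exact absurd h (hJ.getElem_lt_of_corner hst s.isLt ht).ne

theorem IsYoungDiagram.exists_corner {J : List ℕ} (hJ : IsYoungDiagram J) {k : ℕ} (hk : k ∈ J) :
    ∃ s : Fin J.length, J.getD (s + 1) 0 < J[s] ∧ J[s] = k := by
  obtain ⟨i, hi, hik⟩ := List.mem_iff_getElem.1 hk
  obtain ⟨s, hs, hmax⟩ := (univ.filter fun s : Fin J.length => J[s] = k).exists_max_image id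
    ⟨⟨i, hi⟩, by simpa using hik⟩
  have hsk : J[s] = k := (mem_filter.1 hs).2
  refine ⟨s, ?_, hsk⟩
  by_cases h : (s : ℕ) + 1 < J.length
  · rw [List.getD_eq_getElem _ _ h]
    refine lt_of_le_of_ne (hJ.getElem_le (Nat.le_succ _) h) fun heq => ?_
    have := hmax ⟨s + 1, h⟩ (mem_filter.2 ⟨mem_univ _, heq.trans hsk⟩)
    exact absurd this (by simp [Fin.le_def])
  · rw [List.getD_eq_default _ _ (not_lt.1 h), hsk]
    exact hJ.2 k hk

theorem IsYoungDiagram.decreaseAt {J : List ℕ} (hJ : IsYoungDiagram J) {s : Fin J.length}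
    (hs : J.getD (s + 1) 0 < J[s]) : IsYoungDiagram (decreaseAt J s) := by
  refine ⟨?_, fun j hj => by simpa using (List.mem_filter.1 hj).2⟩
  refine (List.Pairwise.filter _ (List.pairwise_iff_getElem.2 ?_)).sortedGE
  intro i j hi hj hij
  rw [List.length_set] at hi hj
  rw [List.getElem_set, List.getElem_set]
  have hle := hJ.getElem_le hij.le hj
  split_ifs with h1 h2 h2
  · omega
  · subst h1
    exact Nat.le_sub_one_of_lt (hJ.getElem_lt_of_corner hij hj hs)
  · subst h2
    exact (Nat.sub_le _ _).trans hle
  · exact hle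

theorem sum_filter_pos (M : Multiset ℕ) : (M.filter (0 < ·)).sum = M.sum := by
  induction M using Multiset.induction_on with
  | empty => rfl
  | cons k M ih =>
    rcases Nat.eq_zero_or_pos k with rfl | hk
    · simpa using ih
    · simp [hk, ih]

theorem coe_set_eq_cons_erase (J : List ℕ) (s : Fin J.length) (x : ℕ) :
    (↑(J.set s x) : Multiset ℕ) = x ::ₘ (↑J : Multiset ℕ).erase J[s] := by
  rw [Multiset.coe_eq_coe.2 (List.set_perm_cons_eraseIdx s.isLt x), ← Multiset.cons_coe,
    ← Multiset.coe_eq_coe.2 (List.getElem_cons_eraseIdx_perm s.isLt), ← Multiset.cons_coe]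
  congr 1
  exact (Multiset.erase_cons_head _ _).symm

theorem coe_decreaseAt {ι : Type*} [Fintype ι] {J : List ℕ} {a : ι →₀ ℕ}
    (ha : (↑J : Multiset ℕ) = (univ.val.map a).filter (0 < ·)) {s : Fin J.length} {r : ι}
    (hs : 0 < J[s]) (hr : a r = J[s]) :
    (↑(decreaseAt J s) : Multiset ℕ) =
      (univ.val.map (a - Finsupp.single r 1 : ι →₀ ℕ)).filter (0 < ·) := by
  classical
  have huniv : (univ : Finset ι).val = r ::ₘ (univ.erase r).val := by
    rw [← insert_val_of_notMem (notMem_erase r univ), insert_erase (mem_univ r)]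
  have hrest : (univ.erase r).val.map (a - Finsupp.single r 1 : ι →₀ ℕ) =
      (univ.erase r).val.map a := by
    refine Multiset.map_congr rfl fun i hi => ?_
    have : i ≠ r := (mem_erase.1 hi).1
    simp [this.symm]
  rw [huniv, Multiset.map_cons, hr, Multiset.filter_cons_of_pos _ hs] at ha
  have hdec : (↑(decreaseAt J s) : Multiset ℕ) =
      (↑(J.set s (J[s] - 1)) : Multiset ℕ).filter (0 < ·) := by
    simp [decreaseAt]
  have hfilter : ((univ.erase r).val.map a).filter (0 < ·) =
      (((univ.erase r).val.map a).filter (0 < ·)).filter (0 < ·) := by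
    simp
  rw [hdec, coe_set_eq_cons_erase, ha, Multiset.erase_cons_head, huniv, Multiset.map_cons, hrest,
    ← Multiset.singleton_add, ← Multiset.singleton_add, Multiset.filter_add, Multiset.filter_add,
    ← hfilter]
  simp [hr]

/-- The `n_k(J)` variables with exponent `k` contribute equal terms, which accounts for the factor
`n_k(J)`. Zero exponents are allowed so that the variables stay fixed when a row disappears. -/
theorem coeff_youngPolynomial {ι K : Type*} [Fintype ι] [CommRing K] (n : ℕ) :
    ∀ (J : List ℕ) (a : ι →₀ ℕ), IsYoungDiagram J → ∑ r, a r = n →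
      (↑J : Multiset ℕ) = (univ.val.map a).filter (0 < ·) →
      (youngPolynomial ι K n).coeff a = youngD J := by
  classical
  induction n with
  | zero =>
    intro J a hJ hn ha
    have h0 : a = 0 := by
      ext r
      exact (sum_eq_zero_iff.1 hn) r (mem_univ r)
    have hJ0 : J = [] := by
      rw [← Multiset.coe_eq_zero, ha, h0, Multiset.filter_eq_nil]
      intro k hk
      obtain ⟨r, _, rfl⟩ := Multiset.mem_map.1 hk
      simp
    rw [hJ0, h0, youngPolynomial_zero, youngD]
    simp
  | succ n ih =>
    intro J a hJ hn ha
    have hsum : J.sum = n + 1 := by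
      rw [← hn, ← Multiset.sum_coe, ha]
      exact sum_filter_pos _
    have hne : J ≠ [] := by
      rintro rfl
      simp at hsum
    have hpos : ∀ s : Fin J.length, 0 < J[s] := fun s => hJ.2 _ (List.getElem_mem s.isLt)
    have hcount : ∀ k, 0 < k → J.count k = #{r | a r = k} := by
      intro k hk
      rw [← Multiset.coe_count, ha, Multiset.count_filter_of_pos hk, Multiset.count_map]
      simp [card_def, eq_comm]
    have hmem : ∀ r, 0 < a r → a r ∈ J := by
      intro r hr
      rw [← Multiset.mem_coe, ha, Multiset.mem_filter]
      exact ⟨Multiset.mem_map_of_mem _ (mem_univ r), hr⟩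
    have hle : ∀ s : Fin J.length, J[s] ≤ J.sum := fun s =>
      List.le_sum_of_mem (List.getElem_mem s.isLt)
    have hterm : ∀ s : Fin J.length, ((if _h : J.getD (s + 1) 0 < J[s] then
        (J.sum - J[s] + 1) * J.count J[s] * youngD (decreaseAt J s) else 0 : ℕ) : K) =
        ∑ r, if J.getD (s + 1) 0 < J[s] ∧ a r = J[s] then
          ((n + 1 : ℕ) - a r + 1 : K) * (youngPolynomial ι K n).coeff (a - Finsupp.single r 1)
          else 0 := by
      intro s
      split_ifs with hs
      · have hr : ∀ r ∈ ({r | a r = J[s]} : Finset ι),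
            ((n + 1 : ℕ) - a r + 1 : K) *
              (youngPolynomial ι K n).coeff (a - Finsupp.single r 1) =
            (J.sum - J[s] + 1 : ℕ) * youngD (decreaseAt J s) := by
          intro r hr
          have hr' : a r = J[s] := (mem_filter.1 hr).2
          rw [← hsum, ih (decreaseAt J s) _ (hJ.decreaseAt hs) _ (coe_decreaseAt ha (hpos s) hr'), hr',
            Nat.cast_add, Nat.cast_sub (hle s), Nat.cast_one]
          have h1 : Finsupp.single r 1 ≤ a := Finsupp.single_le_iff.2 (hr' ▸ hpos s)
          have h2 : ∑ i, (a - Finsupp.single r 1 : ι →₀ ℕ) i +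
              ∑ i, (Finsupp.single r 1 : ι →₀ ℕ) i = ∑ i, a i := by
            rw [← sum_add_distrib]
            exact sum_congr rfl fun i _ => Nat.sub_add_cancel (h1 i)
          rw [hn, Finsupp.univ_sum_single_apply] at h2
          exact Nat.succ_injective h2
        simp only [hs, true_and]
        rw [← sum_filter, sum_congr rfl hr, sum_const, hcount _ (hpos s)]
        simp
        ring
      · rw [Nat.cast_zero]
        exact (sum_eq_zero fun r _ => if_neg fun h => hs h.1).symm
    -- After exchanging the sums, each variable with positive exponent meets exactly one corner, the
    -- last row of that length.
    rw [youngD, if_neg hne, Nat.cast_sum, sum_congr rfl fun s _ => hterm s, sum_comm,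
      coeff_youngPolynomial_succ]
    refine sum_congr rfl fun r _ => ?_
    split_ifs with hr
    · obtain ⟨s, hs, hsr⟩ := hJ.exists_corner (hmem r hr)
      rw [sum_eq_single_of_mem s (mem_univ s), if_pos ⟨hs, hsr.symm⟩]
      intro t _ hts
      exact if_neg fun ht => hts (hJ.corner_unique ht.1 hs (ht.2.symm.trans hsr.symm))
    · refine (sum_eq_zero fun s _ => if_neg fun hs => hr ?_).symm
      rw [hs.2]
      exact hpos s

end Corners

theorem theorem4 (p : ℕ) (hp : p.Prime) (J : List ℕ) (hJ : IsYoungDiagram J)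
    (hN : J.sum = p - 1) : youngD J ≡ 1 [MOD p] := by
  have : Fact p.Prime := ⟨hp⟩
  -- One variable per row, with the row length as exponent.
  let a : Fin J.length →₀ ℕ := Finsupp.equivFunOnFinite.symm J.get
  have hmap : (Finset.univ.val.map a : Multiset ℕ) = ↑J := by
    rw [Fin.univ_val_map]
    exact congrArg _ (List.ofFn_get J)
  have hsum : ∑ r, a r = p - 1 := by
    rw [← hN, ← Multiset.sum_coe, ← hmap]
    rfl
  have ha : (↑J : Multiset ℕ) = (Finset.univ.val.map a).filter (0 < ·) := by
    rw [hmap]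
    exact (Multiset.filter_eq_self.2 hJ.2).symm
  rw [← ZMod.natCast_eq_natCast_iff, ← coeff_youngPolynomial (p - 1) J a hJ hsum ha,
    coeff_youngPolynomial_pred a hsum, Nat.cast_one]
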